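/- Let $M:\mathbb Z_+\times\mathbb Z_+\to\{0,1\}$ be a transition matrix, let $\boldsymbol\Sigma=\{x\in\mathbb Z_+^{\mathbb Z_+}: M(x_j,x_{j+1})=1 \text{ for all } j\ge 0\}$ be the associated one-sided Markov subshift, assumed non-empty, and let $\sigma(x_0,x_1,x_2,\dots)=(x_1,x_2,\dots)$ be the shift. Fix $\lambda\in(0,1)$ and equip $\boldsymbol\Sigma$ with the metric $d(x,y)=\lambda^{\min\{j:\,x_j\ne y_j\}}$ for $x\ne y$. Let $\mathcal B_0$ be the set of symbols $i$ with $M(i,j)=1$ for some $j$, and $\mathcal B_{n}$, $n\ge1$, the set of symbols $i$ with $M(i,j)=1$ for some $j\in\mathcal B_{n-1}$. Suppose that $M$ is finitely primitive: there are a finite set $\mathbb F\subset\mathbb Z_+$ and an integer $K_0\ge 0$ such that for all $i,j\in\bigcap_{n\ge0}\mathcal B_n$ there are $\ell_1,\dots,\ell_{K_0}\in\mathbb F$ with $M(i,\ell_1)M(\ell_1,\ell_2)\cdots M(\ell_{K_0},j)=1$. Put $I_{\mathbb F}=\max\mathbb F$ (with $I_{\mathbb F}=0$ if $\mathbb F=\emptyset$),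 and $\Sigma_I=\{x\in\boldsymbol\Sigma: x_j\le I \text{ for all } j\}$ for $I\in\mathbb Z_+$. Let $A:\boldsymbol\Sigma\to\mathbb R$ be bounded above, coercive, i.e. $\lim_{i\to\infty}\sup\{A(x):x\in\boldsymbol\Sigma,\ x_0=i\}=-\infty$ (with $\sup\emptyset=-\infty$), and locally Hölder continuous, i.e. there is $H_A>0$ such that for every integer $k\ge1$, $A(x)-A(y)\le H_A\lambda^k$ whenever $d(x,y)\le\lambda^k$. Let $\mathcal M_\sigma$ be the set of $\sigma$-invariant Borel probability measures on $\boldsymbol\Sigma$, let $\beta_A=\sup_{\mu\in\mathcal M_\sigma}\int A\,d\mu$ (integrals take values in $[-\infty,\infty)$), and call $\mu\in\mathcal M_\sigma$ $A$-maximizing if $\int A\,d\mu=\beta_A$. Then there is an integer $\hat I>I_{\mathbb F}$ such that $$\beta_A=\max_{\mu\in\mathcal M_\sigma,\ \operatorname{supp}\mu\subseteq\Sigma_{\hat I}}\int A\,d\mu,$$ the maximum being attained; in particular, $A$-maximizing measures exist. Furthermore, there is a compact set $\Omega\subseteq\Sigma_{\hat I}$ with $\sigma(\Omega)\subseteq\Omega$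 such that $\mu\in\mathcal M_\sigma$ is $A$-maximizing if and only if $\operatorname{supp}\mu\subseteq\Omega$. -/

import Mathlib

open MeasureTheory Filter Topology

namespace CountableMarkov

/-- `alive M n` is the set `B_n` of symbols: `B_0` is the set of symbols with a successor, and
`B_{n+1}` is the set of symbols with a successor in `B_n`. A transition matrix with entries in
`{0, 1}` is given by the relation `M i j` saying that the entry at `(i, j)` is `1`. -/
def alive (M : ℕ → ℕ → Prop) : ℕ → Set ℕ
  | 0 => {i | ∃ j, M i j}
  | n + 1 => {i | ∃ j ∈ alive M n, M i j}

/-- `M` is primitive, with set of intermediate symbols `F` and number of intermediate symbols `K₀`: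
any two symbols `i, j` of `⋂ n, B_n` are joined by an admissible word `i ℓ₁ ⋯ ℓ_{K₀} j`
with all `ℓ_k` in `F`. Finite primitivity is this property for a finite `F`. -/
def PrimitiveWith (M : ℕ → ℕ → Prop) (F : Set ℕ) (K₀ : ℕ) : Prop :=
  ∀ i ∈ ⋂ n, alive M n, ∀ j ∈ ⋂ n, alive M n,
    ∃ w : ℕ → ℕ, w 0 = i ∧ w (K₀ + 1) = j ∧
      (∀ k, 1 ≤ k → k ≤ K₀ → w k ∈ F) ∧ ∀ k ≤ K₀, M (w k) (w (k + 1))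

/-- The greatest element of a finite set of symbols (`0` for the empty set). -/
def maxSymbol (F : Finset ℕ) : ℕ := F.sup id

/-- The one-sided Markov subshift of `M`. It carries the topology and the Borel `σ`-algebra induced
by the product `ℕ → ℕ`. -/
abbrev Shift (M : ℕ → ℕ → Prop) : Type := {x : ℕ → ℕ // ∀ j, M (x j) (x (j + 1))}

/-- The left shift map. -/
def shift (M : ℕ → ℕ → Prop) (x : Shift M) : Shift M :=
  ⟨fun j => x.1 (j + 1), fun j => x.2 (j + 1)⟩

open Classical in
/-- The metric `d(x, y) = r ^ min {j | x_j ≠ y_j}` (and `0` if `x = y`). -/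
noncomputable def shiftDist {M : ℕ → ℕ → Prop} (r : ℝ) (x y : Shift M) : ℝ :=
  if x = y then 0 else r ^ sInf {j | x.1 j ≠ y.1 j}

theorem shiftDist_le_iff {M : ℕ → ℕ → Prop} {r : ℝ} (h0 : 0 < r) (h1 : r < 1) (x y : Shift M)
    (k : ℕ) : shiftDist r x y ≤ r ^ k ↔ ∀ j < k, x.1 j = y.1 j := by
  unfold shiftDist
  split_ifs with h
  · subst h
    simp [pow_nonneg h0.le k]
  · rw [pow_le_pow_iff_right_of_lt_one₀ h0 h1]
    have hne : {j | x.1 j ≠ y.1 j}.Nonempty := by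
      by_contra hc
      rw [Set.not_nonempty_iff_eq_empty] at hc
      apply h
      ext j
      by_contra hj
      have : j ∈ {j | x.1 j ≠ y.1 j} := hj
      rw [hc] at this
      exact this
    constructor
    · intro hk j hj
      by_contra hc
      have := Nat.sInf_le (show j ∈ {j | x.1 j ≠ y.1 j} from hc)
      omega
    · intro hk
      by_contra hc
      exact Nat.sInf_mem hne (hk _ (by omega))

/-- The topology of `Shift M` is the one given by the metric `shiftDist r`. -/
theorem isOpen_iff_shiftDist {M : ℕ → ℕ → Prop} {r : ℝ} (h0 : 0 < r) (h1 : r < 1)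
    (s : Set (Shift M)) :
    IsOpen s ↔ ∀ x ∈ s, ∃ ε > 0, ∀ y, shiftDist r x y < ε → y ∈ s := by
  constructor
  · rintro ⟨t, ht, rfl⟩ x hx
    obtain ⟨I, u, hu, hsub⟩ := isOpen_pi_iff.1 ht x.1 hx
    refine ⟨r ^ (I.sup id + 1), pow_pos h0 _, fun y hy => hsub ?_⟩
    intro j hj
    have hj' : j ≤ I.sup id := Finset.le_sup (f := id) hj
    rw [← (shiftDist_le_iff h0 h1 x y _).1 hy.le j (by omega)]
    exact (hu j hj).2
  · intro h
    rw [isOpen_iff_mem_nhds]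
    intro x hx
    obtain ⟨ε, hε, hs⟩ := h x hx
    obtain ⟨k, hk⟩ := exists_pow_lt_of_lt_one hε h1
    have hopen : IsOpen {y : Shift M | ∀ j < k, x.1 j = y.1 j} := by
      have : {y : Shift M | ∀ j < k, x.1 j = y.1 j} =
          ⋂ j ∈ Finset.range k, (fun y : Shift M => y.1 j) ⁻¹' {x.1 j} := by
        ext y
        simp [eq_comm]
      rw [this]
      refine isOpen_biInter_finset fun j _ => ?_
      exact (isOpen_discrete _).preimage ((continuous_apply j).comp continuous_subtype_val)
    refine Filter.mem_of_superset (hopen.mem_nhds (fun j _ => rfl)) fun y hy => hs y ?_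
    exact ((shiftDist_le_iff h0 h1 x y k).2 hy).trans_lt hk

/-- Local Hölder continuity: for some `H > 0` and all `k ≥ 1`, the `k`-th variation
`sup {A x - A y | d(x, y) ≤ r ^ k}` is at most `H * r ^ k`. -/
def LocallyHolder {M : ℕ → ℕ → Prop} (r : ℝ) (A : Shift M → ℝ) : Prop :=
  ∃ H > 0, ∀ k : ℕ, 1 ≤ k → ∀ x y : Shift M, shiftDist r x y ≤ r ^ k → A x - A y ≤ H * r ^ k

/-- Coerciveness: `sup A|_[i] → -∞` as `i → ∞` (the supremum over an empty cylinder is `-∞`). -/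
def Coercive {M : ℕ → ℕ → Prop} (A : Shift M → ℝ) : Prop :=
  Tendsto (fun i : ℕ => ⨆ x : {x : Shift M // x.1 0 = i}, (A x.1 : EReal)) atTop (𝓝 ⊥)

/-- The shift-invariant Borel probability measures. -/
def invMeasures (M : ℕ → ℕ → Prop) : Set (Measure (Shift M)) :=
  {μ | IsProbabilityMeasure μ ∧ MeasurePreserving (shift M) μ μ}

/-- The integral `∫ A⁺ dμ - ∫ A⁻ dμ` in `[-∞, ∞]`. For `A` bounded above and `μ` a probability
measure the first term is finite, and the value is `-∞` when `A` is not integrable. -/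
noncomputable def extIntegral {M : ℕ → ℕ → Prop} (A : Shift M → ℝ) (μ : Measure (Shift M)) :
    EReal :=
  ((∫⁻ x, ENNReal.ofReal (A x) ∂μ : ENNReal) : EReal) -
    ((∫⁻ x, ENNReal.ofReal (-A x) ∂μ : ENNReal) : EReal)

/-- The ergodic maximizing value. -/
noncomputable def ergodicMax {M : ℕ → ℕ → Prop} (A : Shift M → ℝ) : EReal :=
  ⨆ μ ∈ invMeasures M, extIntegral A μ

/-- `A`-maximizing measures. -/
def IsMaximizing {M : ℕ → ℕ → Prop} (A : Shift M → ℝ) (μ : Measure (Shift M)) : Prop :=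
  μ ∈ invMeasures M ∧ extIntegral A μ = ergodicMax A

/-- The subshift of the points all of whose symbols are in `{0, …, I}`. -/
def finiteShift (M : ℕ → ℕ → Prop) (I : ℕ) : Set (Shift M) := {x | ∀ j, x.1 j ≤ I}

end CountableMarkov

/-! The proof rests on a bounded continuous sub-action `u`, with `A + u ≤ β + u ∘ σ` on the whole
shift and strict inequality wherever the first symbol exceeds `I`. Integrating this against an
invariant measure cancels `u`. Hence every integral is at most `β`, with equality exactly when
contact holds almost everywhere (`extIntegral_le_and_eq_iff`). An orbit that stays in contact uses
only symbols up to `I`, so the contact core is the compact set `Ω`.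

Here `β` is the maximum of the integral over measures carried by the compact subshift `Σ_I`. By
primitivity, a word with symbols up to `I` closes up to a periodic orbit in `Σ_I`, whose mean is at
most `β`. Bounded distortion then bounds the Birkhoff sums of `A - β` over such words by a constant
`C` independent of `I` (`birkhoffSum_sub_le_of_periodic`). The supremum of these sums over words put
in front of `x` is `u x`, and `0 ≤ u ≤ C` (`exists_subaction`). Since `C` does not depend on `I`,
coerciveness allows `I` to be taken so large that `A < β - C` beyond it; there the sub-action
inequality is automatic and strict. -/

namespace CountableMarkov

variable {M : ℕ → ℕ → Prop}

/-! ### Periodic points and concatenation of words. -/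

theorem shift_iterate_apply (x : Shift M) (n j : ℕ) :
    ((shift M)^[n] x).1 j = x.1 (j + n) := by
  induction n generalizing x with
  | zero => rfl
  | succ n ih =>
    rw [Function.iterate_succ_apply, ih]
    rfl

theorem apply_mem_alive (x : Shift M) (j n : ℕ) : x.1 j ∈ alive M n := by
  induction n generalizing j with
  | zero => exact ⟨_, x.2 j⟩
  | succ n ih => exact ⟨_, ih (j + 1), x.2 j⟩

/-- A closed admissible word can be repeated periodically. -/
theorem exists_periodic_of_word {v : ℕ → ℕ} {p : ℕ} (hp : 0 < p)
    (hv : ∀ q < p, M (v q) (v (q + 1))) (hvp : v p = v 0) :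
    ∃ z : Shift M, (∀ q < p, z.1 q = v q) ∧ (shift M)^[p] z = z ∧ ∀ m, ∃ q < p, z.1 m = v q := by
  refine ⟨⟨fun m => v (m % p), fun m => ?_⟩, fun q hq => ?_, ?_, fun m => ?_⟩
  · have hlt := Nat.mod_lt m hp
    have h := hv _ hlt
    rcases (show m % p + 1 ≤ p from hlt).lt_or_eq with h1 | h1
    · have : (m + 1) % p = m % p + 1 := by
        rw [← Nat.mod_add_mod, Nat.mod_eq_of_lt h1]
      simpa only [this] using h
    · have : (m + 1) % p = 0 := by
        rw [← Nat.mod_add_mod, h1, Nat.mod_self]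
      rw [h1, hvp] at h
      simpa only [this] using h
  · simp [Nat.mod_eq_of_lt hq]
  · apply Subtype.ext
    funext j
    rw [shift_iterate_apply]
    simp
  · exact ⟨m % p, Nat.mod_lt m hp, rfl⟩

/-- Under primitivity the first `n` symbols of a point are the first symbols of a periodic point
of period `n + K₀`, whose other symbols lie in `F`. -/
theorem PrimitiveWith.exists_periodic {F : Set ℕ} {K₀ : ℕ} (hM : PrimitiveWith M F K₀)
    (y : Shift M) {n : ℕ} (hn : 0 < n) :
    ∃ z : Shift M, (∀ q < n, z.1 q = y.1 q) ∧ (∀ q, n ≤ q → q < n + K₀ → z.1 q ∈ F) ∧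
      (shift M)^[n + K₀] z = z ∧ ∀ m, (∃ q < n, z.1 m = y.1 q) ∨ z.1 m ∈ F := by
  obtain ⟨w, hw0, hw1, hwF, hwM⟩ := hM (y.1 (n - 1))
    (Set.mem_iInter.2 fun _ => apply_mem_alive y _ _) (y.1 0)
    (Set.mem_iInter.2 fun _ => apply_mem_alive y _ _)
  -- The index `q - n + 1` skips `w 0`, which is already present as `y.1 (n - 1)`; the last symbol
  -- `w (K₀ + 1) = y.1 0` falls at position `n + K₀` and closes the word.
  let v : ℕ → ℕ := fun q => if q < n then y.1 q else w (q - n + 1)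
  have hv1 : ∀ q < n, v q = y.1 q := fun q hq => if_pos hq
  have hv2 : ∀ q, n ≤ q → v q = w (q - n + 1) := fun q hq => if_neg hq.not_gt
  obtain ⟨z, hz1, hz2, hz3⟩ := exists_periodic_of_word (M := M) (v := v) (p := n + K₀) (by omega)
    (by
      intro q hq
      rcases lt_trichotomy (q + 1) n with h | h | h
      · rw [hv1 _ h, hv1 _ (by omega)]
        exact y.2 q
      · rw [hv1 _ (by omega), hv2 _ h.ge]
        have := hwM 0 (by omega)
        rw [hw0] at this
        convert this using 2 <;> omega
      · rw [hv2 _ (by omega), hv2 _ (by omega)]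
        have := hwM (q - n + 1) (by omega)
        convert this using 2
        omega)
    (by
      rw [hv1 0 hn, hv2 _ (by omega), ← hw1]
      congr 1
      omega)
  have hF : ∀ q, n ≤ q → q < n + K₀ → v q ∈ F := fun q h1 h2 => by
    rw [hv2 q h1]
    exact hwF _ (by omega) (by omega)
  refine ⟨z, fun q hq => by rw [hz1 q (by omega), hv1 q hq],
    fun q h1 h2 => by rw [hz1 q h2]; exact hF q h1 h2, hz2, fun m => ?_⟩
  obtain ⟨q, hq, hzq⟩ := hz3 m
  rw [hzq]
  rcases lt_or_ge q n with h | h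
  · exact Or.inl ⟨q, h, hv1 q h⟩
  · exact Or.inr (hF q h hq)

/-- The first `n` symbols of a preimage of `x` can be put in front of any point with the same
first symbol as `x`. -/
theorem exists_preimage_of_apply_zero_eq (y : Shift M) (n : ℕ) {x : Shift M}
    (h : x.1 0 = y.1 n) :
    ∃ y' : Shift M, (shift M)^[n] y' = x ∧ ∀ q < n, y'.1 q = y.1 q := by
  refine ⟨⟨fun q => if q < n then y.1 q else x.1 (q - n), fun q => ?_⟩, ?_, fun q hq => if_pos hq⟩
  · beta_reduce
    rcases lt_trichotomy (q + 1) n with h1 | h1 | h1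
    · rw [if_pos h1, if_pos (by omega)]
      exact y.2 q
    · rw [if_pos (by omega), if_neg (by omega), show q + 1 - n = 0 by omega, h, ← h1]
      exact y.2 q
    · rw [if_neg (Nat.not_lt.2 (Nat.lt_succ_iff.1 h1)), if_neg h1.not_gt, show q + 1 - n = q - n + 1 by omega]
      exact x.2 _
  · apply Subtype.ext
    funext j
    rw [shift_iterate_apply]
    simp

/-! ### Topology of the shift and bounded distortion. -/

theorem continuous_shift : Continuous (shift M) :=
  continuous_induced_rng.2
    (continuous_pi fun j => (continuous_apply (j + 1)).comp continuous_subtype_val)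

/-- The cylinders of a point are neighbourhoods. -/
theorem eventually_apply_eq (x : Shift M) (k : ℕ) :
    ∀ᶠ y : Shift M in 𝓝 x, ∀ j < k, y.1 j = x.1 j := by
  have : ∀ j ∈ Finset.range k, ∀ᶠ y : Shift M in 𝓝 x, y.1 j = x.1 j := fun j _ =>
    ((continuous_apply j).comp continuous_subtype_val).continuousAt.eventually
      (eventually_of_mem (isOpen_discrete {x.1 j} |>.mem_nhds rfl) fun _ h => h)
  filter_upwards [(Finset.eventually_all _).2 this] with y hy j hj
  exact hy j (Finset.mem_range.2 hj)

/-- A function whose oscillation on cylinders of length `k` is at most `C * r ^ k`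
is continuous. -/
theorem continuous_of_variation_le {r C : ℝ} (hr0 : 0 < r) (hr1 : r < 1) {f : Shift M → ℝ}
    (hf : ∀ k, 1 ≤ k → ∀ x y : Shift M, (∀ j < k, x.1 j = y.1 j) → f x - f y ≤ C * r ^ k) :
    Continuous f := by
  rw [continuous_iff_continuousAt]
  intro x
  rw [Metric.continuousAt_iff']
  intro ε hε
  have hlim : Tendsto (fun k : ℕ => C * r ^ k) atTop (𝓝 0) := by
    simpa using (tendsto_pow_atTop_nhds_zero_of_lt_one hr0.le hr1).const_mul C
  obtain ⟨k, hk, hk1⟩ := ((hlim.eventually_lt_const hε).and (eventually_ge_atTop 1)).exists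
  filter_upwards [eventually_apply_eq x k] with y hy
  rw [Real.dist_eq, abs_lt]
  have h1 := hf k hk1 x y fun j hj => (hy j hj).symm
  have h2 := hf k hk1 y x hy
  constructor <;> linarith

/-- Bounded distortion of Birkhoff sums. -/
theorem birkhoffSum_sub_le {r H : ℝ} (hr0 : 0 < r) (hr1 : r < 1) {A : Shift M → ℝ}
    (hA : ∀ k, 1 ≤ k → ∀ x y : Shift M, (∀ j < k, x.1 j = y.1 j) → A x - A y ≤ H * r ^ k)
    (k n : ℕ) (x y : Shift M) (hxy : ∀ j < n + k, x.1 j = y.1 j) :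
    birkhoffSum (shift M) A n x - birkhoffSum (shift M) A n y ≤
      H / (1 - r) * r ^ k * (1 - r ^ n) := by
  induction n generalizing x y with
  | zero => simp
  | succ n ih =>
    rw [birkhoffSum_succ', birkhoffSum_succ']
    have h1 := ih (shift M x) (shift M y) fun j hj => hxy (j + 1) (by omega)
    have h2 := hA (n + 1 + k) (by omega) x y hxy
    -- The bound is the geometric sum of `H * r ^ (k + j)` over `j < n`. It wastes a factor `r`, but
    -- every variation used has index at least `1`, so `k = 0` is allowed.
    have h3 : H / (1 - r) * r ^ k * (1 - r ^ (n + 1)) =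
        H / (1 - r) * r ^ k * (1 - r ^ n) + H * r ^ (n + k) := by
      have : (1 - r) ≠ 0 := by linarith
      field_simp
      ring
    have hH : 0 ≤ H := by
      have := hA 1 le_rfl x x fun _ _ => rfl
      rw [sub_self, pow_one] at this
      exact nonneg_of_mul_nonneg_left this hr0
    have h4 : H * r ^ (n + 1 + k) ≤ H * r ^ (n + k) :=
      mul_le_mul_of_nonneg_left (pow_le_pow_of_le_one hr0.le hr1.le (by omega)) hH
    linarith

theorem isClosed_finiteShift (I : ℕ) : IsClosed (finiteShift M I) := by
  have : finiteShift M I = ⋂ j, (fun x : Shift M => x.1 j) ⁻¹' Set.Iic I := by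
    ext x
    simp [finiteShift]
  rw [this]
  exact isClosed_iInter fun j =>
    (isClosed_discrete _).preimage ((continuous_apply j).comp continuous_subtype_val)

theorem isClosed_setOf_admissible (M : ℕ → ℕ → Prop) :
    IsClosed {x : ℕ → ℕ | ∀ j, M (x j) (x (j + 1))} := by
  rw [Set.ofPred_forall]
  refine isClosed_iInter fun j => ?_
  have hc : Continuous fun x : ℕ → ℕ => (x j, x (j + 1)) := by fun_prop
  exact (isClosed_discrete {p : ℕ × ℕ | M p.1 p.2}).preimage hc

theorem isCompact_finiteShift (I : ℕ) : IsCompact (finiteShift M I) := by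
  rw [Subtype.isCompact_iff]
  have : Subtype.val '' finiteShift M I =
      {x : ℕ → ℕ | ∀ j, M (x j) (x (j + 1))} ∩ Set.univ.pi fun _ => Set.Iic I := by
    ext x
    constructor
    · rintro ⟨y, hy, rfl⟩
      exact ⟨y.2, fun j _ => hy j⟩
    · rintro ⟨h1, h2⟩
      exact ⟨⟨x, h1⟩, fun j => h2 j trivial, rfl⟩
  rw [this]
  exact (isCompact_univ_pi fun _ => (Set.finite_Iic I).isCompact).inter_left
    (isClosed_setOf_admissible M)

theorem mapsTo_shift_finiteShift (I : ℕ) :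
    Set.MapsTo (shift M) (finiteShift M I) (finiteShift M I) :=
  fun _ hx j => hx (j + 1)

/-! ### Bounded Birkhoff sums and the sub-action. -/

/-- If Birkhoff sums over periodic orbits with symbols at most `I` are at most `β` times the
period, then the Birkhoff sums of `A - β` over words with symbols at most `I` are bounded, by a
constant that does not depend on `I`. -/
theorem birkhoffSum_sub_le_of_periodic {F : Set ℕ} {K₀ : ℕ} (hM : PrimitiveWith M F K₀)
    {r H : ℝ} (hr0 : 0 < r) (hr1 : r < 1) {A : Shift M → ℝ}
    (hA : ∀ k, 1 ≤ k → ∀ x y : Shift M, (∀ j < k, x.1 j = y.1 j) → A x - A y ≤ H * r ^ k)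
    {m B β : ℝ} (hm0 : 0 ≤ m) (hm : ∀ x : Shift M, x.1 0 ∈ F → -m ≤ A x)
    (hB0 : 0 ≤ B) (hβ : β ≤ B) {I : ℕ} (hFI : ∀ i ∈ F, i ≤ I)
    (hper : ∀ p > 0, ∀ z ∈ finiteShift M I, (shift M)^[p] z = z →
      birkhoffSum (shift M) A p z ≤ p * β)
    (n : ℕ) (y : Shift M) (hy : ∀ j < n, y.1 j ≤ I) :
    birkhoffSum (shift M) A n y - n * β ≤ H / (1 - r) + K₀ * (B + m) := by
  have hH : 0 ≤ H := by
    have := hA 1 le_rfl y y fun _ _ => rfl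
    rw [sub_self, pow_one] at this
    exact nonneg_of_mul_nonneg_left this hr0
  have hD : 0 ≤ H / (1 - r) := div_nonneg hH (by linarith)
  rcases Nat.eq_zero_or_pos n with rfl | hn
  · simp only [birkhoffSum_zero, Nat.cast_zero, zero_mul, sub_zero]
    positivity
  obtain ⟨z, hz1, hz2, hz3, hz4⟩ := hM.exists_periodic y hn
  have h1 := hper _ (by omega) z (fun j => by
    rcases hz4 j with ⟨q, hq, h⟩ | h
    · rw [h]; exact hy q hq
    · exact hFI _ h) hz3
  have h2 := birkhoffSum_sub_le hr0 hr1 hA 0 n y z fun j hj => (hz1 j hj).symm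
  rw [birkhoffSum_add] at h1
  have h3 : -(K₀ * m) ≤ birkhoffSum (shift M) A K₀ ((shift M)^[n] z) := by
    have := Finset.card_nsmul_le_sum (Finset.range K₀)
      (fun k => A ((shift M)^[k] ((shift M)^[n] z))) (-m) fun k hk => hm _ (by
        rw [shift_iterate_apply, shift_iterate_apply]
        have := Finset.mem_range.1 hk
        exact hz2 _ (by omega) (by omega))
    rw [Finset.card_range, nsmul_eq_mul] at this
    unfold birkhoffSum
    linarith
  have h4 : H / (1 - r) * r ^ 0 * (1 - r ^ n) ≤ H / (1 - r) := by
    rw [pow_zero, mul_one]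
    exact mul_le_of_le_one_right hD (by linarith [pow_pos hr0 n])
  -- Replacing `β` by its a priori bound `B` keeps the final constant independent of `β`, hence of
  -- `I`.
  have h5 : (K₀ : ℝ) * β ≤ K₀ * B := mul_le_mul_of_nonneg_left hβ (Nat.cast_nonneg _)
  push_cast at h1
  linarith

/-- The Birkhoff sums of `A - β` over the preimages of `x` that are obtained by putting a word with
symbols at most `I` in front of `x`. -/
def preimageSums (A : Shift M → ℝ) (β : ℝ) (I : ℕ) (x : Shift M) : Set ℝ :=
  {v | ∃ (n : ℕ) (y : Shift M), (shift M)^[n] y = x ∧ (∀ j < n, y.1 j ≤ I) ∧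
    v = birkhoffSum (shift M) A n y - n * β}

/-- If the Birkhoff sums of `A - β` over words with symbols at most `I` are bounded by `C` and
`A < β - C` outside of these symbols, then `A` has a bounded continuous sub-action for the
constant `β`. -/
theorem exists_subaction {r H : ℝ} (hr0 : 0 < r) (hr1 : r < 1) {A : Shift M → ℝ}
    (hA : ∀ k, 1 ≤ k → ∀ x y : Shift M, (∀ j < k, x.1 j = y.1 j) → A x - A y ≤ H * r ^ k)
    {β C : ℝ} {I : ℕ}
    (hC : ∀ (n : ℕ) (y : Shift M), (∀ j < n, y.1 j ≤ I) →
      birkhoffSum (shift M) A n y - n * β ≤ C)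
    (hI : ∀ x : Shift M, I < x.1 0 → A x + C < β) :
    ∃ u : Shift M → ℝ, Continuous u ∧ (∀ x, 0 ≤ u x) ∧ (∀ x, u x ≤ C) ∧
      (∀ x, A x + u x ≤ β + u (shift M x)) ∧
      ∀ x : Shift M, I < x.1 0 → A x + u x < β + u (shift M x) := by
  have hbdd : ∀ x, ∀ v ∈ preimageSums A β I x, v ≤ C := by
    rintro x _ ⟨n, y, -, hy, rfl⟩
    exact hC n y hy
  -- The empty word contributes `0`, so the supremum is over a non-empty set and is nonnegative.
  have hzero : ∀ x, (0 : ℝ) ∈ preimageSums A β I x := fun x =>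
    ⟨0, x, rfl, fun j hj => absurd hj j.not_lt_zero, by simp⟩
  have hle : ∀ x, ∀ v ∈ preimageSums A β I x, v ≤ sSup (preimageSums A β I x) := fun x v hv =>
    le_csSup ⟨C, hbdd x⟩ hv
  have hnonneg : ∀ x, 0 ≤ sSup (preimageSums A β I x) := fun x => hle x 0 (hzero x)
  have hub : ∀ x, sSup (preimageSums A β I x) ≤ C := fun x => csSup_le ⟨0, hzero x⟩ (hbdd x)
  have hout : ∀ x : Shift M, I < x.1 0 → A x + sSup (preimageSums A β I x) <
      β + sSup (preimageSums A β I (shift M x)) := fun x hx => by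
    linarith [hI x hx, hub x, hnonneg (shift M x)]
  refine ⟨fun x => sSup (preimageSums A β I x), ?_, hnonneg, hub, fun x => ?_, hout⟩
  · refine continuous_of_variation_le (C := H / (1 - r)) hr0 hr1 fun k hk x x' hxx' => ?_
    rw [sub_le_iff_le_add]
    refine csSup_le ⟨0, hzero x⟩ ?_
    rintro _ ⟨n, y, rfl, hy, rfl⟩
    -- The same word is put in front of `x'`, which is admissible because `k ≥ 1` gives `x` and `x'`
    -- the same first symbol. The two preimages agree on `n + k` symbols, so distortion compares
    -- their sums.
    obtain ⟨y', hy'1, hy'2⟩ := exists_preimage_of_apply_zero_eq y n (x := x') (by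
      rw [← hxx' 0 (by omega), shift_iterate_apply, zero_add])
    have h1 := birkhoffSum_sub_le hr0 hr1 hA k n y y' (by
      intro j hj
      rcases lt_or_ge j n with h | h
      · exact (hy'2 j h).symm
      · have := hxx' (j - n) (by omega)
        rwa [← hy'1, shift_iterate_apply, shift_iterate_apply, Nat.sub_add_cancel h] at this)
    have h2 := hle x' _ ⟨n, y', hy'1, fun j hj => by rw [hy'2 j hj]; exact hy j hj, rfl⟩
    have hH : 0 ≤ H := by
      have := hA 1 le_rfl y y fun _ _ => rfl
      rw [sub_self, pow_one] at this
      exact nonneg_of_mul_nonneg_left this hr0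
    have hD : 0 ≤ H / (1 - r) * r ^ k :=
      mul_nonneg (div_nonneg hH (by linarith)) (pow_nonneg hr0.le k)
    have h3 : H / (1 - r) * r ^ k * (1 - r ^ n) ≤ H / (1 - r) * r ^ k :=
      mul_le_of_le_one_right hD (by linarith [pow_pos hr0 n])
    linarith
  · rcases lt_or_ge I (x.1 0) with hx | hx
    · exact (hout x hx).le
    · rw [add_comm, ← le_sub_iff_add_le]
      refine csSup_le ⟨0, hzero x⟩ ?_
      rintro _ ⟨n, y, rfl, hy, rfl⟩
      rw [shift_iterate_apply, zero_add] at hx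
      -- As the first symbol of `x` is at most `I`, appending it to the word gives an admissible
      -- competitor for the supremum at the shifted point.
      have := hle (shift M ((shift M)^[n] y)) _ ⟨n + 1, y, Function.iterate_succ_apply' _ _ _,
        fun j hj => by
          rcases (Nat.lt_succ_iff.1 hj).lt_or_eq with h | rfl
          exacts [hy j h, hx], rfl⟩
      rw [birkhoffSum_succ] at this
      push_cast at this
      linarith

end CountableMarkov

/-! ### Invariant measures of general and of compact systems. -/

/-- The equidistribution on a periodic orbit is an invariant probability measure. -/
theorem exists_invariant_of_periodic {X : Type*} [MeasurableSpace X] {T : X → X}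
    (hT : Measurable T) {p : ℕ} (hp : 0 < p) {z : X} (hz : T^[p] z = z) :
    ∃ μ : ProbabilityMeasure X, MeasurePreserving T (μ : Measure X) μ ∧
      ∀ f : X → ℝ, StronglyMeasurable f →
        ∫ x, f x ∂(μ : Measure X) = (p : ℝ)⁻¹ * birkhoffSum T f p z := by
  let ν : Measure X := ∑ j ∈ Finset.range p, Measure.dirac (T^[j] z)
  have hν : ν Set.univ = p := by simp [ν]
  have hp0 : (p : ENNReal) ≠ 0 := by exact_mod_cast hp.ne'
  have hpt : (p : ENNReal) ≠ ⊤ := ENNReal.natCast_ne_top p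
  refine ⟨⟨(p : ENNReal)⁻¹ • ν, ⟨?_⟩⟩, ⟨hT, ?_⟩, fun f hf => ?_⟩
  · rw [Measure.smul_apply, hν, smul_eq_mul, ENNReal.inv_mul_cancel hp0 hpt]
  · change Measure.map T ((p : ENNReal)⁻¹ • ν) = (p : ENNReal)⁻¹ • ν
    rw [Measure.map_smul]
    congr 1
    have h1 : Measure.map T ν = ∑ j ∈ Finset.range p, Measure.dirac (T^[j + 1] z) := by
      rw [← Measure.mapₗ_apply_of_measurable hT, map_sum]
      refine Finset.sum_congr rfl fun j _ => ?_
      rw [Measure.mapₗ_apply_of_measurable hT, Measure.map_dirac' hT, Function.iterate_succ_apply']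
    rw [h1]
    -- Pushing forward rotates the orbit: the new last term at `T^[p] z = z` is the old first one.
    obtain ⟨q, rfl⟩ : ∃ q, p = q + 1 := ⟨p - 1, by omega⟩
    rw [Finset.sum_range_succ, hz]
    simp only [ν]
    rw [Finset.sum_range_succ']
    rfl
  · change ∫ x, f x ∂((p : ENNReal)⁻¹ • ν) = _
    rw [integral_smul_measure, integral_finsetSum_measure]
    · simp [integral_dirac' _ _ hf, birkhoffSum]
    · intro j _
      exact (integrable_const (f (T^[j] z))).congr (by
        rw [Filter.EventuallyEq, ae_dirac_iff (stronglyMeasurable_const.measurableSet_eq_fun hf)])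

/-- A continuous self-map of a compact metrizable space that has an invariant probability measure
has one that maximizes the integral of a given continuous function. -/
theorem exists_maximizing_invariant {X : Type*} [TopologicalSpace X] [CompactSpace X]
    [TopologicalSpace.MetrizableSpace X] [MeasurableSpace X] [BorelSpace X] {T : X → X}
    (hT : Continuous T) {f : X → ℝ} (hf : Continuous f)
    (hne : ∃ μ : ProbabilityMeasure X, MeasurePreserving T (μ : Measure X) μ) :
    ∃ μ : ProbabilityMeasure X, MeasurePreserving T (μ : Measure X) μ ∧
      ∀ ν : ProbabilityMeasure X, MeasurePreserving T (ν : Measure X) ν →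
        ∫ x, f x ∂(ν : Measure X) ≤ ∫ x, f x ∂(μ : Measure X) := by
  -- Invariant measures are the fixed points of the continuous push-forward, so they form a closed
  -- subset of a compact space.
  have heq : {μ : ProbabilityMeasure X | MeasurePreserving T (μ : Measure X) μ} =
      {μ | μ.map hT.measurable.aemeasurable = μ} := by
    ext μ
    refine ⟨fun h => Subtype.ext h.map_eq, fun h => ⟨hT.measurable, ?_⟩⟩
    exact congrArg Subtype.val h
  have hclosed : IsClosed {μ : ProbabilityMeasure X | MeasurePreserving T (μ : Measure X) μ} := by
    rw [heq]
    exact isClosed_eq (ProbabilityMeasure.continuous_map hT) continuous_id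
  have hcont : Continuous fun μ : ProbabilityMeasure X => ∫ x, f x ∂(μ : Measure X) :=
    ProbabilityMeasure.continuous_integral_boundedContinuousFunction
      (BoundedContinuousFunction.mkOfCompact ⟨f, hf⟩)
  obtain ⟨μ, hμ, hmax⟩ := hclosed.isCompact.exists_isMaxOn hne hcont.continuousOn
  exact ⟨μ, hμ, fun ν hν => hmax hν⟩

namespace CountableMarkov

variable {M : ℕ → ℕ → Prop}

/-! ### Extended integrals and the contact locus. -/

theorem extIntegral_eq_integral {A : Shift M → ℝ} {μ : Measure (Shift M)} (hA : Integrable A μ) :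
    extIntegral A μ = ((∫ x, A x ∂μ : ℝ) : EReal) := by
  rw [integral_eq_lintegral_pos_part_sub_lintegral_neg_part hA, EReal.coe_sub, extIntegral,
    EReal.coe_ennreal_toReal, EReal.coe_ennreal_toReal]
  · exact hA.neg.lintegral_lt_top.ne
  · exact hA.lintegral_lt_top.ne

theorem extIntegral_eq_bot {A : Shift M → ℝ} {μ : Measure (Shift M)} [IsFiniteMeasure μ]
    (hA : Measurable A) (hbdd : BddAbove (Set.range A)) (hint : ¬ Integrable A μ) :
    extIntegral A μ = ⊥ := by
  obtain ⟨B, hB⟩ := hbdd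
  have hpos : ∫⁻ x, ENNReal.ofReal (A x) ∂μ ≠ ⊤ := by
    refine ((lintegral_mono fun x =>
      ENNReal.ofReal_le_ofReal (hB (Set.mem_range_self x))).trans_lt ?_).ne
    rw [lintegral_const]
    exact ENNReal.mul_lt_top ENNReal.ofReal_lt_top (measure_lt_top μ _)
  have hneg : ∫⁻ x, ENNReal.ofReal (-A x) ∂μ = ⊤ := by
    by_contra hne
    refine hint ⟨hA.aestronglyMeasurable, ?_⟩
    have hle : ∫⁻ x, ‖A x‖ₑ ∂μ ≤
        ∫⁻ x, (ENNReal.ofReal (A x) + ENNReal.ofReal (-A x)) ∂μ := by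
      refine lintegral_mono fun x => ?_
      rw [Real.enorm_eq_ofReal_abs]
      rcases abs_cases (A x) with ⟨h, -⟩ | ⟨h, -⟩ <;> rw [h]
      exacts [le_self_add, le_add_self]
    rw [lintegral_add_left hA.ennreal_ofReal] at hle
    exact hle.trans_lt (ENNReal.add_lt_top.2 ⟨hpos.lt_top, Ne.lt_top hne⟩)
  rw [extIntegral, hneg, EReal.coe_ennreal_top, EReal.sub_top]

/-- A bounded continuous sub-action bounds the integrals with respect to invariant measures, and
equality holds for the measures that are carried by its contact locus. -/
theorem extIntegral_le_and_eq_iff {A : Shift M → ℝ} (hA : Continuous A)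
    (hbdd : BddAbove (Set.range A)) {u : Shift M → ℝ} (hu : Continuous u) {β C : ℝ}
    (hu0 : ∀ x, 0 ≤ u x) (huC : ∀ x, u x ≤ C) (hle : ∀ x, A x + u x ≤ β + u (shift M x))
    {μ : Measure (Shift M)} (hμ : μ ∈ invMeasures M) :
    extIntegral A μ ≤ β ∧
      (extIntegral A μ = β ↔ ∀ᵐ x ∂μ, A x + u x = β + u (shift M x)) := by
  obtain ⟨hprob, hinv⟩ := hμ
  have hui : Integrable u μ := Integrable.of_bound hu.measurable.aestronglyMeasurable C
    (Eventually.of_forall fun x => by rw [Real.norm_of_nonneg (hu0 x)]; exact huC x)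
  have huTi : Integrable (fun x => u (shift M x)) μ :=
    hinv.integrable_comp_of_integrable hui
  have huT : ∫ x, u (shift M x) ∂μ = ∫ x, u x ∂μ := by
    have := integral_map (μ := μ) hinv.measurable.aemeasurable (f := u)
      hu.measurable.aestronglyMeasurable
    rw [hinv.map_eq] at this
    exact this.symm
  by_cases hint : Integrable A μ
  · have hGi : Integrable (fun x => β + u (shift M x) - (A x + u x)) μ :=
      ((integrable_const β).add huTi).sub (hint.add hui)
    have hG : ∫ x, (β + u (shift M x) - (A x + u x)) ∂μ = β - ∫ x, A x ∂μ := by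
      have h1 : ∫ x, (β + u (shift M x) - (A x + u x)) ∂μ =
          ∫ x, (β + u (shift M x)) ∂μ - ∫ x, (A x + u x) ∂μ :=
        integral_sub ((integrable_const β).add huTi) (hint.add hui)
      rw [h1, integral_add (integrable_const β) huTi, integral_add hint hui, huT]
      simp
    have hG0 : 0 ≤ fun x => β + u (shift M x) - (A x + u x) := fun x => sub_nonneg.2 (hle x)
    have h0 := integral_nonneg (μ := μ) hG0
    have hiff := integral_eq_zero_iff_of_nonneg hG0 hGi
    rw [hG] at h0 hiff
    rw [extIntegral_eq_integral hint, EReal.coe_le_coe_iff, EReal.coe_eq_coe_iff, eq_comm,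
      ← sub_eq_zero, hiff]
    refine ⟨by linarith, eventually_congr (Eventually.of_forall fun x => ?_)⟩
    rw [Pi.zero_apply, sub_eq_zero, eq_comm]
  -- Both sides of the equivalence fail here: contact almost everywhere would make `A` equal almost
  -- everywhere to the integrable function `β + u ∘ σ - u`.
  · rw [extIntegral_eq_bot hA.measurable hbdd hint]
    refine ⟨bot_le, fun h => absurd h.symm (EReal.coe_ne_bot β), fun h => absurd ?_ hint⟩
    refine (((integrable_const β).add huTi).sub hui).congr ?_
    filter_upwards [h] with x hx
    simp only [Pi.sub_apply, Pi.add_apply]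
    linarith

/-- The largest forward invariant subset of the contact locus of a sub-action. -/
def contactCore (A u : Shift M → ℝ) (β : ℝ) : Set (Shift M) :=
  {x | ∀ n, A ((shift M)^[n] x) + u ((shift M)^[n] x) = β + u (shift M ((shift M)^[n] x))}

theorem isClosed_contactCore {A u : Shift M → ℝ} (hA : Continuous A) (hu : Continuous u)
    (β : ℝ) : IsClosed (contactCore A u β) := by
  unfold contactCore
  rw [Set.ofPred_forall]
  refine isClosed_iInter fun n => ?_
  have hn : Continuous (shift M)^[n] := continuous_shift.iterate n
  exact isClosed_eq ((hA.comp hn).add (hu.comp hn))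
    (continuous_const.add (hu.comp (continuous_shift.comp hn)))

theorem mapsTo_contactCore (A u : Shift M → ℝ) (β : ℝ) :
    Set.MapsTo (shift M) (contactCore A u β) (contactCore A u β) :=
  fun _ hx n => hx (n + 1)

/-- Invariance carries contact almost everywhere to all iterates, so the core has full measure;
being closed, it contains the support. Conversely the support itself has full measure. -/
theorem ae_contact_iff_support_subset {A u : Shift M → ℝ} (hA : Continuous A)
    (hu : Continuous u) {β : ℝ} {μ : Measure (Shift M)} (hμ : μ ∈ invMeasures M) :
    (∀ᵐ x ∂μ, A x + u x = β + u (shift M x)) ↔ μ.support ⊆ contactCore A u β := by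
  constructor
  · intro h
    refine Measure.support_subset_of_isClosed (isClosed_contactCore hA hu β) ?_
    exact ae_all_iff.2 fun n => (hμ.2.iterate n).quasiMeasurePreserving.ae h
  · intro h
    filter_upwards [Measure.support_mem_ae (μ := μ)] with x hx
    exact h hx 0

/-! ### Maximization on a finite subshift, and bounds on `A` by the first symbol. -/

/-- If some point has all its symbols in `{0, …, I}` and is periodic, the integral of `A` has a
maximum among the invariant measures carried by `{0, …, I}`. -/
theorem exists_maximizing_on_finiteShift {A : Shift M → ℝ} (hA : Continuous A) {I : ℕ}
    {z₀ : Shift M} (hz₀I : z₀ ∈ finiteShift M I) {p₀ : ℕ} (hp₀ : 0 < p₀)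
    (hz₀ : (shift M)^[p₀] z₀ = z₀) :
    ∃ (β : ℝ) (μ : Measure (Shift M)), μ ∈ invMeasures M ∧ μ.support ⊆ finiteShift M I ∧
      extIntegral A μ = β ∧ ∀ p > 0, ∀ z ∈ finiteShift M I, (shift M)^[p] z = z →
        birkhoffSum (shift M) A p z ≤ p * β := by
  let T : finiteShift M I → finiteShift M I := (mapsTo_shift_finiteShift I).restrict
  have hT : Continuous T := continuous_shift.restrict (mapsTo_shift_finiteShift I)
  let f : finiteShift M I → ℝ := fun x => A x.1
  have hf : Continuous f := hA.comp continuous_subtype_val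
  have : CompactSpace (finiteShift M I) := isCompact_iff_compactSpace.1 (isCompact_finiteShift I)
  have : TopologicalSpace.MetrizableSpace (finiteShift M I) :=
    (IsEmbedding.subtypeVal.comp IsEmbedding.subtypeVal).metrizableSpace
  have hval : ∀ (n : ℕ) (x : finiteShift M I), (T^[n] x).1 = (shift M)^[n] x.1 := fun n x =>
    (Function.Semiconj.iterate_right (f := Subtype.val) (ga := T) (gb := shift M)
      (fun _ => rfl) n) x
  have hper : ∀ p > 0, ∀ z (hz : z ∈ finiteShift M I), (shift M)^[p] z = z →
      ∃ μ : ProbabilityMeasure (finiteShift M I),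
        MeasurePreserving T (μ : Measure (finiteShift M I)) μ ∧
        ∫ x, f x ∂(μ : Measure (finiteShift M I)) =
          (p : ℝ)⁻¹ * birkhoffSum (shift M) A p z := by
    intro p hp z hz hpz
    obtain ⟨μ, hμ, h⟩ := exists_invariant_of_periodic hT.measurable hp (z := ⟨z, hz⟩)
      (Subtype.ext (by rw [hval]; exact hpz))
    refine ⟨μ, hμ, ?_⟩
    rw [h f hf.stronglyMeasurable]
    congr 1
    refine Finset.sum_congr rfl fun j _ => ?_
    simp only [f]
    rw [hval]
  obtain ⟨μ, hμ, hmax⟩ := exists_maximizing_invariant hT hf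
    ((hper p₀ hp₀ z₀ hz₀I hz₀).imp fun _ h => h.1)
  have hvm : Measurable (Subtype.val : finiteShift M I → Shift M) := measurable_subtype_coe
  have hprob : IsProbabilityMeasure ((μ : Measure (finiteShift M I)).map Subtype.val) :=
    Measure.isProbabilityMeasure_map hvm.aemeasurable
  have hint : Integrable f (μ : Measure (finiteShift M I)) :=
    (BoundedContinuousFunction.mkOfCompact ⟨f, hf⟩).integrable _
  refine ⟨∫ x, f x ∂(μ : Measure (finiteShift M I)),
    (μ : Measure (finiteShift M I)).map Subtype.val,
    ⟨hprob, continuous_shift.measurable, ?_⟩, ?_, ?_, fun p hp z hz hpz => ?_⟩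
  · rw [Measure.map_map continuous_shift.measurable hvm]
    conv_rhs => rw [← hμ.map_eq]
    rw [Measure.map_map hvm hT.measurable]
    rfl
  · refine Measure.support_subset_of_isClosed (isClosed_finiteShift I) ?_
    exact (ae_map_iff hvm.aemeasurable (isClosed_finiteShift I).measurableSet).2
      (Eventually.of_forall fun x => x.2)
  · rw [extIntegral_eq_integral, integral_map hvm.aemeasurable
      hA.measurable.aestronglyMeasurable]
    rw [integrable_map_measure hA.measurable.aestronglyMeasurable hvm.aemeasurable]
    exact hint
  -- The equidistribution on the orbit of `z` competes in the maximum.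
  · obtain ⟨ν, hν, h⟩ := hper p hp z hz hpz
    have hp' : (0 : ℝ) < p := Nat.cast_pos.2 hp
    rw [← inv_mul_le_iff₀ hp', ← h]
    exact hmax ν hν

/-- A function of bounded variation on cylinders of length one is bounded below on a finite union
of such cylinders. -/
theorem exists_forall_neg_le_of_apply_zero_mem {r H : ℝ} {A : Shift M → ℝ}
    (hA : ∀ k, 1 ≤ k → ∀ x y : Shift M, (∀ j < k, x.1 j = y.1 j) → A x - A y ≤ H * r ^ k)
    (F : Finset ℕ) : ∃ m, 0 ≤ m ∧ ∀ x : Shift M, x.1 0 ∈ F → -m ≤ A x := by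
  induction F using Finset.induction with
  | empty => exact ⟨0, le_rfl, fun x hx => absurd hx (Finset.notMem_empty _)⟩
  | insert i F _ ih =>
    obtain ⟨m, hm0, hm⟩ := ih
    by_cases hi : ∃ x : Shift M, x.1 0 = i
    · obtain ⟨y, hy⟩ := hi
      refine ⟨max m (H * r - A y), le_max_of_le_left hm0, fun x hx => ?_⟩
      rcases Finset.mem_insert.1 hx with h | h
      · have := hA 1 le_rfl y x fun j hj => by
          rw [Nat.lt_one_iff.1 hj, hy, h]
        rw [pow_one] at this
        linarith [le_max_right m (H * r - A y)]
      · linarith [hm x h, le_max_left m (H * r - A y)]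
    · refine ⟨m, hm0, fun x hx => ?_⟩
      rcases Finset.mem_insert.1 hx with h | h
      exacts [absurd ⟨x, h⟩ hi, hm x h]

theorem Coercive.exists_forall_lt {A : Shift M → ℝ} (hA : Coercive A) (b : ℝ) :
    ∃ N, ∀ x : Shift M, N ≤ x.1 0 → A x < b := by
  obtain ⟨N, hN⟩ := eventually_atTop.1 (hA.eventually_lt_const (EReal.bot_lt_coe b))
  refine ⟨N, fun x hx => ?_⟩
  have := (le_iSup (fun y : {y : Shift M // y.1 0 = x.1 0} => (A y.1 : EReal)) ⟨x, rfl⟩).trans_lt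
    (hN _ hx)
  exact EReal.coe_lt_coe_iff.1 this

end CountableMarkov

/-! ### Choice of `I` and conclusion. -/

open CountableMarkov

theorem theorem1 (M : ℕ → ℕ → Prop) (F : Finset ℕ) (K₀ : ℕ)
    (hM : CountableMarkov.PrimitiveWith M (F : Set ℕ) K₀)
    (hne : Nonempty (CountableMarkov.Shift M))
    (r : ℝ) (hr0 : 0 < r) (hr1 : r < 1)
    (A : CountableMarkov.Shift M → ℝ)
    (hbdd : BddAbove (Set.range A))
    (hcoer : CountableMarkov.Coercive A)
    (hhol : CountableMarkov.LocallyHolder r A) :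
    ∃ I : ℕ, CountableMarkov.maxSymbol F < I ∧
      IsGreatest
        {b : EReal | ∃ μ ∈ CountableMarkov.invMeasures M,
          μ.support ⊆ CountableMarkov.finiteShift M I ∧ b = CountableMarkov.extIntegral A μ}
        (CountableMarkov.ergodicMax A) ∧
      (∃ μ, CountableMarkov.IsMaximizing A μ) ∧
      ∃ Ω : Set (CountableMarkov.Shift M),
        IsCompact Ω ∧ Set.MapsTo (CountableMarkov.shift M) Ω Ω ∧
        Ω ⊆ CountableMarkov.finiteShift M I ∧
        ∀ μ ∈ CountableMarkov.invMeasures M,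
          (CountableMarkov.IsMaximizing A μ ↔ μ.support ⊆ Ω) := by
  obtain ⟨H, -, hH⟩ := hhol
  have hA : ∀ k, 1 ≤ k → ∀ x y : Shift M, (∀ j < k, x.1 j = y.1 j) → A x - A y ≤ H * r ^ k :=
    fun k hk x y h => hH k hk x y ((shiftDist_le_iff hr0 hr1 x y k).2 h)
  have hAc : Continuous A := continuous_of_variation_le hr0 hr1 hA
  obtain ⟨B, hB0, hB⟩ : ∃ B, 0 ≤ B ∧ ∀ x, A x ≤ B := by
    obtain ⟨B, hB⟩ := hbdd
    exact ⟨max B 0, le_max_right _ _, fun x => (hB (Set.mem_range_self x)).trans (le_max_left _ _)⟩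
  obtain ⟨m, hm0, hm⟩ := exists_forall_neg_le_of_apply_zero_mem hA F
  have hF : ∀ i ∈ (F : Set ℕ), i ≤ maxSymbol F := fun i hi =>
    Finset.le_sup (f := id) (Finset.mem_coe.1 hi)
  obtain ⟨x₀⟩ := hne
  obtain ⟨z₀, -, -, hz₀, hz₀'⟩ := hM.exists_periodic x₀ Nat.one_pos
  set p₀ := 1 + K₀ with hp₀
  have hp₀pos : 0 < p₀ := by omega
  have hp₀pos' : (0 : ℝ) < p₀ := Nat.cast_pos.2 hp₀pos
  -- This orbit mean is a lower bound for `β` available before `I` is chosen. Since `b` and `C` do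
  -- not involve `I`, there is no circularity in choosing `N`, then `I`, then `β`.
  set b := (p₀ : ℝ)⁻¹ * birkhoffSum (shift M) A p₀ z₀ with hb
  set C := H / (1 - r) + K₀ * (B + m) with hC
  obtain ⟨N, hN⟩ := hcoer.exists_forall_lt (b - C)
  -- Including `x₀.1 0` puts the periodic point `z₀` in `Σ_I`, so that the maximum defining `β` is
  -- over a non-empty set.
  set I := max (max (x₀.1 0) (maxSymbol F + 1)) N with hI
  have hIF : maxSymbol F < I := by omega
  have hz₀I : z₀ ∈ finiteShift M I := fun j => by
    rcases hz₀' j with ⟨q, hq, h⟩ | h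
    · rw [h, Nat.lt_one_iff.1 hq]
      omega
    · exact (hF _ h).trans hIF.le
  obtain ⟨β, μ, hμ, hμI, hμβ, hper⟩ := exists_maximizing_on_finiteShift hAc hz₀I hp₀pos hz₀
  have hbβ : b ≤ β := by
    rw [hb, inv_mul_le_iff₀ hp₀pos']
    exact hper p₀ hp₀pos z₀ hz₀I hz₀
  have hβB : β ≤ B := by
    have hint : Integrable A μ := by
      by_contra h
      have := hμ.1
      rw [extIntegral_eq_bot hAc.measurable hbdd h] at hμβ
      exact EReal.coe_ne_bot β hμβ.symm
    have := hμ.1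
    rw [extIntegral_eq_integral hint, EReal.coe_eq_coe_iff] at hμβ
    rw [← hμβ]
    simpa using integral_mono hint (integrable_const B) hB
  obtain ⟨u, huc, hu0, huC, hle, hlt⟩ := exists_subaction hr0 hr1 hA (β := β) (C := C) (I := I)
    (birkhoffSum_sub_le_of_periodic hM hr0 hr1 hA hm0 hm hB0 hβB
      (fun i hi => (hF i hi).trans hIF.le) hper)
    (fun x hx => by linarith [hN x (by omega)])
  have key := fun ν (hν : ν ∈ invMeasures M) =>
    extIntegral_le_and_eq_iff hAc hbdd huc hu0 huC hle hν
  have hmax : ergodicMax A = β :=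
    le_antisymm (iSup₂_le fun ν hν => (key ν hν).1)
      (hμβ ▸ le_iSup₂ (f := fun ν (_ : ν ∈ invMeasures M) => extIntegral A ν) μ hμ)
  -- The `j`-th iterate starts with the symbol `x.1 j`; a symbol beyond `I` would make the
  -- inequality there strict.
  have hΩI : contactCore A u β ⊆ finiteShift M I := fun x hx j => by
    by_contra h
    have := hlt ((shift M)^[j] x) (by rw [shift_iterate_apply, zero_add]; omega)
    exact this.ne (hx j)
  refine ⟨I, hIF, ⟨⟨μ, hμ, hμI, hmax.trans hμβ.symm⟩, ?_⟩, ⟨μ, hμ, hμβ.trans hmax.symm⟩,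
    contactCore A u β, (isCompact_finiteShift I).of_isClosed_subset
      (isClosed_contactCore hAc huc β) hΩI, mapsTo_contactCore A u β, hΩI, fun ν hν => ?_⟩
  · rintro _ ⟨ν, hν, -, rfl⟩
    rw [hmax]
    exact (key ν hν).1
  · rw [← ae_contact_iff_support_subset hAc huc hν, ← (key ν hν).2, IsMaximizing, hmax]
    exact and_iff_right hν
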